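/- Let $\alpha\in(0,2)$ and let $m:\mathbb{R}\to[0,\infty)$ be a Borel function with $\int_{\mathbb{R}} m^\alpha(x)\,dx<\infty$. Let $X=\{X(t),\,t\in\mathbb{R}\}$ be a symmetric $\alpha$-stable (S$\alpha$S) moving average with kernel $m$, i.e. $$X(t)=\int_{\mathbb{R}} m(t-x)\,\Lambda(dx),\qquad t\in\mathbb{R},$$ where $\Lambda$ is an S$\alpha$S random measure on $\mathbb{R}$ with Lebesgue control measure: an independently scattered, almost surely $\sigma$-additive random set function on the Borel sets of finite Lebesgue measure with $\mathbb{E}\,e^{is\Lambda(A)}=e^{-|A|\,|s|^\alpha}$, $s\in\mathbb{R}$; the integral is the limit in probability of the integrals of simple functions of finite-measure support converging in $L^\alpha(\mathbb{R})$ to the integrand. If $$\int_{\mathbb{R}}\int_{\mathbb{R}} \min\{m^\alpha(x),m^\alpha(t)\}\,dx\,dt=\infty,$$ then $X$ is long range dependent, that is, $X$ is stationary (its finite-dimensional distributions are invariant under translations) and there exists a finite Borel measure $\mu$ on $\mathbb{R}$ such that $$\int_{\mathbb{R}}\int_{\mathbb{R}}\int_{\mathbb{R}}\bigl|\operatorname{Cov}\bigl(\mathbf{1}\{X(0)>u\},\mathbf{1}\{X(t)>v\}\bigr)\bigr|\,\mu(du)\,\mu(dv)\,dt=\infty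 .$$ -/

import Mathlib

open MeasureTheory ProbabilityTheory Filter Topology

noncomputable section

/-- `Λ` is a symmetric `α`-stable random measure on `ℝ` with Lebesgue control measure, defined on
the Borel sets of finite Lebesgue measure (the values of `Λ` on other sets play no role):
it is an independently scattered, almost surely `σ`-additive random set function such that
`Λ(A)` has characteristic function `s ↦ exp (-|A| |s| ^ α)`. -/
structure IsSaSRandomMeasure {Ω : Type*} [MeasurableSpace Ω] (P : Measure Ω) (α : ℝ)
    (Λ : Set ℝ → Ω → ℝ) : Prop where
  measurable : ∀ A : Set ℝ, MeasurableSet A → volume A < ⊤ → Measurable (Λ A)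
  charFun_eq : ∀ A : Set ℝ, MeasurableSet A → volume A < ⊤ → ∀ s : ℝ,
    charFun (P.map (Λ A)) s = ((Real.exp (-((volume A).toReal * |s| ^ α)) : ℝ) : ℂ)
  indep : ∀ (n : ℕ) (A : Fin n → Set ℝ), (∀ i, MeasurableSet (A i)) → (∀ i, volume (A i) < ⊤) →
    Pairwise (Function.onFun Disjoint A) → iIndepFun (fun i => Λ (A i)) P
  /-- The series converges as a sequence of partial sums; for `α ≥ 1` it need not converge
  absolutely. -/
  sigma_additive : ∀ A : ℕ → Set ℝ, (∀ i, MeasurableSet (A i)) → volume (⋃ i, A i) < ⊤ →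
    Pairwise (Function.onFun Disjoint A) →
    ∀ᵐ ω ∂P, Tendsto (fun n => ∑ i ∈ Finset.range n, Λ (A i) ω) atTop (𝓝 (Λ (⋃ i, A i) ω))

/-- The integral `∫ f dΛ = ∑ c, c Λ(f = c)` of a simple function (used only for simple functions
which vanish outside a set of finite measure). -/
def simpleStableIntegral {Ω : Type*} (Λ : Set ℝ → Ω → ℝ) (f : SimpleFunc ℝ ℝ) : Ω → ℝ :=
  fun ω => ∑ c ∈ f.range, c * Λ (f ⁻¹' {c}) ω

/-- `Y` is (a version of) the stable integral `∫ f dΛ` of `f ∈ L^α(ℝ)`: it is the limit in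
probability of `∫ fₙ dΛ` for simple functions `fₙ`, each vanishing outside a set of finite measure,
which converge to `f` in `L^α(ℝ)`. -/
def IsStableIntegral {Ω : Type*} [MeasurableSpace Ω] (P : Measure Ω) (α : ℝ)
    (Λ : Set ℝ → Ω → ℝ) (f : ℝ → ℝ) (Y : Ω → ℝ) : Prop :=
  ∃ F : ℕ → SimpleFunc ℝ ℝ, (∀ n, (F n).FinMeasSupp volume) ∧
    Tendsto (fun n => eLpNorm (fun x => F n x - f x) (ENNReal.ofReal α) volume) atTop (𝓝 0) ∧
    TendstoInMeasure P (fun n => simpleStableIntegral Λ (F n)) atTop Y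

/-- `X = {X(t), t ∈ ℝ}` is a symmetric `α`-stable moving average with kernel `m ∈ L^α(ℝ)`:
`X(t) = ∫ m(t - x) Λ(dx)` for a symmetric `α`-stable random measure `Λ` with Lebesgue control
measure. -/
structure IsSaSMovingAverage {Ω : Type*} [MeasurableSpace Ω] (P : Measure Ω) (α : ℝ)
    (m : ℝ → ℝ) (X : ℝ → Ω → ℝ) : Prop where
  measurable_kernel : Measurable m
  memLp_kernel : MemLp m (ENNReal.ofReal α) volume
  measurable : ∀ t, Measurable (X t)
  exists_integral : ∃ Λ : Set ℝ → Ω → ℝ, IsSaSRandomMeasure P α Λ ∧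
    ∀ t : ℝ, IsStableIntegral P α Λ (fun x => m (t - x)) (X t)

/-- All finite-dimensional distributions of `X` are invariant under translations. -/
def IsStationaryProcess {Ω : Type*} [MeasurableSpace Ω] (P : Measure Ω) (X : ℝ → Ω → ℝ) : Prop :=
  ∀ (n : ℕ) (t : Fin n → ℝ) (h : ℝ),
    IdentDistrib (fun ω i => X (t i + h) ω) (fun ω i => X (t i) ω) P P

/-- `Cov(𝟙{X(0) > u}, 𝟙{X(t) > v})`. -/
def excursionCov {Ω : Type*} [MeasurableSpace Ω] (P : Measure Ω) (X : ℝ → Ω → ℝ)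
    (t u v : ℝ) : ℝ :=
  covariance ({ω | u < X 0 ω}.indicator (fun _ => (1 : ℝ)))
    ({ω | v < X t ω}.indicator (fun _ => (1 : ℝ))) P

/-- `X` is a stationary process for which there is a finite Borel measure `μ` on `ℝ` with
`∫_ℝ ∫_ℝ ∫_ℝ |Cov(𝟙{X(0) > u}, 𝟙{X(t) > v})| μ(du) μ(dv) dt = ∞`. -/
def IsLongRangeDependent {Ω : Type*} [MeasurableSpace Ω] (P : Measure Ω)
    (X : ℝ → Ω → ℝ) : Prop :=
  IsStationaryProcess P X ∧
    ∃ μ : Measure ℝ, IsFiniteMeasure μ ∧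
      ∫⁻ t : ℝ, ∫⁻ v : ℝ, ∫⁻ u : ℝ, ENNReal.ofReal |excursionCov P X t u v| ∂μ ∂μ = ⊤

end

/-
Stable integrals have explicit characteristic functions, so `Cov(cos Y, cos Z)` is explicit for
`Y = ∫ f dΛ` and `Z = ∫ g dΛ`. The parallelogram law and the concavity of `x ↦ x ^ (α / 2)` give
`|a + b| ^ α + |a - b| ^ α + (2 - α) min (|a| ^ α, |b| ^ α) ≤ 2 (|a| ^ α + |b| ^ α)`, and with
`exp x ≥ 1 + x` this bounds `Cov(cos Y, cos Z)` below by a multiple of `∫ min (|f| ^ α, |g| ^ α)`.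

The function `exp (-x² / 2)` links cosines to excursions: it is the mixture of the `cos (s x)` over
a standard Gaussian `s`, and it is also `∫ 𝟙{x > u} (-u exp (-u² / 2)) du`. The first representation
bounds the covariance of `exp (-X(0)² / 2)` and `exp (-X(t)² / 2)` below by a positive multiple of
`∫ min (m ^ α (-x), m ^ α (t - x)) dx`. By the second, the same covariance is at most the double
integral of `|Cov(𝟙{X(0) > u}, 𝟙{X(t) > v})|` against the density `|u| exp (-u² / 2)`. Integrated
over `t`, the lower bound becomes the given divergent double integral by a change of variables.
-/

section LpQuasiNorm

variable {𝓧 E ι : Type*} [MeasurableSpace 𝓧] {μ : Measure 𝓧} [NormedAddCommGroup E]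
  {l : Filter ι}

lemma eLpNorm_add_rpow_min_one_le {f g : 𝓧 → E} (hf : AEStronglyMeasurable f μ)
    (hg : AEStronglyMeasurable g μ) (p : ENNReal) :
    eLpNorm (f + g) p μ ^ (min p 1).toReal ≤
      eLpNorm f p μ ^ (min p 1).toReal + eLpNorm g p μ ^ (min p 1).toReal := by
  rcases le_total 1 p with hp | hp
  · simpa [min_eq_right hp] using eLpNorm_add_le hf hg hp
  rcases eq_or_ne p 0 with rfl | hp0
  · simp
  have hp_top : p ≠ ⊤ := (hp.trans_lt ENNReal.one_lt_top).ne
  have hp_le : p.toReal ≤ 1 := ENNReal.toReal_mono ENNReal.one_ne_top hp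
  have hp_pos : 0 < p.toReal := ENNReal.toReal_pos hp0 hp_top
  have eLpNorm_rpow (h : 𝓧 → E) : eLpNorm h p μ ^ p.toReal = ∫⁻ x, ‖h x‖ₑ ^ p.toReal ∂μ := by
    rw [eLpNorm_eq_lintegral_rpow_enorm_toReal hp0 hp_top, ← ENNReal.rpow_mul,
      one_div_mul_cancel hp_pos.ne', ENNReal.rpow_one]
  simp only [min_eq_left hp, eLpNorm_rpow]
  rw [← lintegral_add_left' (hf.enorm.pow_const _)]
  exact lintegral_mono fun x =>
    (ENNReal.rpow_le_rpow (enorm_add_le _ _) hp_pos.le).trans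
      (ENNReal.rpow_add_le_add_rpow _ _ hp_pos.le hp_le)

lemma tendsto_of_le_add_of_le_add {a e : ι → ENNReal} {b : ENNReal} (hb : b ≠ ⊤)
    (he : Tendsto e l (𝓝 0)) (h_upper : ∀ i, a i ≤ e i + b) (h_lower : ∀ i, b ≤ e i + a i) :
    Tendsto a l (𝓝 b) := by
  have upper : Tendsto (fun i => e i + b) l (𝓝 b) := by simpa using he.add_const b
  have lower : Tendsto (fun i => b - e i) l (𝓝 b) := by
    simpa using ENNReal.Tendsto.sub (tendsto_const_nhds (x := b)) he (Or.inl hb)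
  exact tendsto_of_tendsto_of_tendsto_of_le_of_le lower upper
    (fun i => tsub_le_iff_left.2 (h_lower i)) h_upper

lemma tendsto_eLpNorm_of_tendsto_eLpNorm_sub {F : ι → 𝓧 → E} {f : 𝓧 → E} {p : ENNReal}
    (hF : ∀ i, AEStronglyMeasurable (F i) μ) (hf : MemLp f p μ)
    (h : Tendsto (fun i => eLpNorm (F i - f) p μ) l (𝓝 0)) :
    Tendsto (fun i => eLpNorm (F i) p μ) l (𝓝 (eLpNorm f p μ)) := by
  rcases eq_or_ne p 0 with rfl | hp
  · simp [tendsto_const_nhds]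
  have hr : 0 < (min p 1).toReal :=
    ENNReal.toReal_pos (by simp [hp]) (min_lt_of_right_lt ENNReal.one_lt_top).ne
  have h_rpow : Tendsto (fun i => eLpNorm (F i) p μ ^ (min p 1).toReal) l
      (𝓝 (eLpNorm f p μ ^ (min p 1).toReal)) := by
    refine tendsto_of_le_add_of_le_add (ENNReal.rpow_ne_top_of_nonneg hr.le hf.2.ne)
      (e := fun i => eLpNorm (F i - f) p μ ^ (min p 1).toReal) ?_ (fun i => ?_) fun i => ?_
    · simpa [ENNReal.zero_rpow_of_pos hr] using h.ennrpow_const (min p 1).toReal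
    · simpa using eLpNorm_add_rpow_min_one_le ((hF i).sub hf.1) hf.1 p
    · simpa [eLpNorm_sub_comm f (F i)] using
        eLpNorm_add_rpow_min_one_le (hf.1.sub (hF i)) (hF i) p
  simpa [← ENNReal.rpow_mul, hr.ne'] using h_rpow.ennrpow_const (min p 1).toReal⁻¹

lemma tendsto_eLpNorm_add_zero {F G : ι → 𝓧 → E} {p : ENNReal}
    (hFm : ∀ i, AEStronglyMeasurable (F i) μ) (hGm : ∀ i, AEStronglyMeasurable (G i) μ)
    (hF : Tendsto (fun i => eLpNorm (F i) p μ) l (𝓝 0))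
    (hG : Tendsto (fun i => eLpNorm (G i) p μ) l (𝓝 0)) :
    Tendsto (fun i => eLpNorm (F i + G i) p μ) l (𝓝 0) := by
  have h_bound : Tendsto
      (fun i => ENNReal.LpAddConst p * (eLpNorm (F i) p μ + eLpNorm (G i) p μ)) l (𝓝 0) := by
    simpa using ENNReal.Tendsto.const_mul (hF.add hG) (Or.inr (ENNReal.LpAddConst_lt_top p).ne)
  exact tendsto_of_tendsto_of_tendsto_of_le_of_le tendsto_const_nhds h_bound
    (fun _ => zero_le) fun i => eLpNorm_add_le' (hFm i) (hGm i) p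

lemma integral_norm_rpow_eq_toReal_eLpNorm_rpow {f : 𝓧 → E} {p : ℝ} (hp : 0 < p)
    (hf : AEStronglyMeasurable f μ) :
    ∫ x, ‖f x‖ ^ p ∂μ = (eLpNorm f (ENNReal.ofReal p) μ).toReal ^ p := by
  rw [integral_eq_lintegral_of_nonneg_ae (Eventually.of_forall fun x => by positivity)
      ((hf.norm.aemeasurable.pow_const p).aestronglyMeasurable),
    eLpNorm_eq_lintegral_rpow_enorm_toReal (by simpa using hp) ENNReal.ofReal_ne_top,
    ENNReal.toReal_ofReal hp.le, ← ENNReal.toReal_rpow, ← Real.rpow_mul ENNReal.toReal_nonneg,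
    one_div_mul_cancel hp.ne', Real.rpow_one]
  simp only [← ofReal_norm, ENNReal.ofReal_rpow_of_nonneg (norm_nonneg _) hp.le]

lemma integrable_norm_rpow_of_memLp {f : 𝓧 → E} {p : ℝ} (hp : 0 < p)
    (hf : MemLp f (ENNReal.ofReal p) μ) : Integrable (fun x => ‖f x‖ ^ p) μ := by
  simpa [ENNReal.toReal_ofReal hp.le] using
    hf.integrable_norm_rpow (by simpa using hp) ENNReal.ofReal_ne_top

lemma tendsto_integral_norm_rpow_of_tendsto_eLpNorm_sub {F : ι → 𝓧 → E} {f : 𝓧 → E} {p : ℝ}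
    (hp : 0 < p) (hF : ∀ i, AEStronglyMeasurable (F i) μ) (hf : MemLp f (ENNReal.ofReal p) μ)
    (h : Tendsto (fun i => eLpNorm (F i - f) (ENNReal.ofReal p) μ) l (𝓝 0)) :
    Tendsto (fun i => ∫ x, ‖F i x‖ ^ p ∂μ) l (𝓝 (∫ x, ‖f x‖ ^ p ∂μ)) := by
  simp only [integral_norm_rpow_eq_toReal_eLpNorm_rpow hp (hF _),
    integral_norm_rpow_eq_toReal_eLpNorm_rpow hp hf.1]
  exact ((ENNReal.tendsto_toReal hf.2.ne).comp
    (tendsto_eLpNorm_of_tendsto_eLpNorm_sub hF hf h)).rpow_const (Or.inr hp.le)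

end LpQuasiNorm

section ConvergenceInMeasure

variable {𝓧 E 𝕜 ι : Type*} [MeasurableSpace 𝓧] {μ : Measure 𝓧} [NormedAddCommGroup E]
  {l : Filter ι}

lemma tendstoInMeasure_add {F G : ι → 𝓧 → E} {f g : 𝓧 → E} (hF : TendstoInMeasure μ F l f)
    (hG : TendstoInMeasure μ G l g) : TendstoInMeasure μ (fun i => F i + G i) l (f + g) := by
  rw [tendstoInMeasure_iff_norm] at hF hG ⊢
  intro ε hε
  have h_sum := (hF (ε / 2) (half_pos hε)).add (hG (ε / 2) (half_pos hε))
  rw [add_zero] at h_sum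
  refine tendsto_of_tendsto_of_tendsto_of_le_of_le tendsto_const_nhds h_sum
    (fun _ => zero_le) fun i => (measure_mono fun x hx => ?_).trans (measure_union_le _ _)
  by_contra hx'
  simp only [Set.mem_union, Set.mem_ofPred_eq, not_or, not_le] at hx hx'
  have h_tri : ‖(F i + G i) x - (f + g) x‖ ≤ ‖F i x - f x‖ + ‖G i x - g x‖ := by
    simpa [add_sub_add_comm] using norm_add_le (F i x - f x) (G i x - g x)
  linarith

lemma tendstoInMeasure_const_smul [NormedField 𝕜] [NormedSpace 𝕜 E] {F : ι → 𝓧 → E} {f : 𝓧 → E}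
    (hF : TendstoInMeasure μ F l f) (c : 𝕜) :
    TendstoInMeasure μ (fun i => c • F i) l (c • f) := by
  rcases eq_or_ne c 0 with rfl | hc
  · intro ε hε
    simp [hε.not_ge, tendsto_const_nhds]
  rw [tendstoInMeasure_iff_norm] at hF ⊢
  intro ε hε
  have hc' : 0 < ‖c‖ := norm_pos_iff.2 hc
  refine (hF (ε / ‖c‖) (by positivity)).congr fun i => ?_
  simp [← smul_sub, norm_smul, div_le_iff₀' hc']

end ConvergenceInMeasure

lemma integral_comp_simpleFunc_eq_sum {𝓧 E G : Type*} [MeasurableSpace 𝓧] {μ : Measure 𝓧}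
    [NormedAddCommGroup E] [DecidableEq E] [NormedAddCommGroup G] [NormedSpace ℝ G]
    [CompleteSpace G] {F : SimpleFunc 𝓧 E} (hF : Integrable F μ) {g : E → G} (hg : g 0 = 0) :
    ∫ x, g (F x) ∂μ = ∑ c ∈ F.range with c ≠ 0, μ.real (F ⁻¹' {c}) • g c := by
  have h_int : Integrable (F.map g) μ := SimpleFunc.integrable_iff_finMeasSupp.2
    ((SimpleFunc.integrable_iff_finMeasSupp.1 hF).map hg)
  rw [Finset.sum_filter_of_ne, ← F.map_integral g hF hg,
    SimpleFunc.integral_eq_integral _ h_int]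
  · rfl
  · rintro c - hc rfl
    simp [hg] at hc

section RandomMeasure

variable {Ω : Type*} [MeasurableSpace Ω] {P : Measure Ω} {α : ℝ} {Λ : Set ℝ → Ω → ℝ}

namespace IsSaSRandomMeasure

lemma ae_empty (hΛ : IsSaSRandomMeasure P α Λ) : ∀ᵐ ω ∂P, Λ ∅ ω = 0 := by
  have h_series := hΛ.sigma_additive (fun _ => ∅) (fun _ => .empty) (by simp) fun _ _ _ => by
    simp [Function.onFun]
  filter_upwards [h_series] with ω hω
  simp only [Set.iUnion_empty] at hω
  have h_succ := (tendsto_add_atTop_iff_nat 1).2 hω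
  simp only [Finset.sum_range_succ] at h_succ
  simpa using h_succ.sub hω

lemma ae_union (hΛ : IsSaSRandomMeasure P α Λ) {A B : Set ℝ} (hA : MeasurableSet A)
    (hB : MeasurableSet B) (hAB : Disjoint A B) (hfin : volume (A ∪ B) < ⊤) :
    ∀ᵐ ω ∂P, Λ (A ∪ B) ω = Λ A ω + Λ B ω := by
  let C : ℕ → Set ℝ
    | 0 => A
    | 1 => B
    | _ => ∅
  have hC_union : ⋃ i, C i = A ∪ B := by
    simp [← Set.union_iUnion_nat_succ C, ← Set.union_iUnion_nat_succ (fun i => C (i + 1)), C]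
  have hC_meas : ∀ i, MeasurableSet (C i)
    | 0 => hA
    | 1 => hB
    | _ + 2 => .empty
  have hC_disj : Pairwise (Function.onFun Disjoint C) := by
    rintro (_ | _ | i) (_ | _ | j) hij <;> simp_all [Function.onFun, C, disjoint_comm]
  filter_upwards [hΛ.sigma_additive C hC_meas (by rwa [hC_union]) hC_disj, hΛ.ae_empty]
    with ω h_series h_empty
  rw [hC_union] at h_series
  refine tendsto_nhds_unique h_series (tendsto_atTop_of_eventually_const (i₀ := 2) fun n hn => ?_)
  rw [Finset.eventually_constant_sum (N := 2) _ hn]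
  · simp [Finset.sum_range_succ, C]
  · rintro (_ | _ | i) hi
    · omega
    · omega
    · exact h_empty

lemma ae_preimage_finset (hΛ : IsSaSRandomMeasure P α Λ) {β : Type*}
    (G : SimpleFunc ℝ β) (S : Finset β) (hS : volume (G ⁻¹' S) < ⊤) :
    ∀ᵐ ω ∂P, Λ (G ⁻¹' S) ω = ∑ b ∈ S, Λ (G ⁻¹' {b}) ω := by
  classical
  induction S using Finset.induction_on with
  | empty => simpa using hΛ.ae_empty
  | insert a S ha ih =>
    rw [Finset.coe_insert, Set.insert_eq, Set.preimage_union] at hS ⊢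
    filter_upwards [ih ((measure_mono Set.subset_union_right).trans_lt hS),
      hΛ.ae_union (G.measurableSet_preimage _) (G.measurableSet_preimage _)
        (Disjoint.preimage _ (by simpa using ha)) hS] with ω h_sum h_union
    rw [h_union, h_sum, Finset.sum_insert ha]

lemma ae_simpleStableIntegral_map (hΛ : IsSaSRandomMeasure P α Λ) {β : Type*}
    (G : SimpleFunc ℝ β) (φ : β → ℝ) (hG : (G.map φ).FinMeasSupp volume) :
    ∀ᵐ ω ∂P, simpleStableIntegral Λ (G.map φ) ω =
      ∑ b ∈ G.range, φ b * Λ (G ⁻¹' {b}) ω := by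
  classical
  have h_fiber (c : ℝ) : ∀ᵐ ω ∂P, c * Λ (G.map φ ⁻¹' {c}) ω =
      c * ∑ b ∈ G.range with φ b = c, Λ (G ⁻¹' {b}) ω := by
    rcases eq_or_ne c 0 with rfl | hc
    · simp
    · have h_fin := hG.meas_preimage_singleton_ne_zero hc
      rw [SimpleFunc.map_preimage_singleton] at h_fin ⊢
      filter_upwards [hΛ.ae_preimage_finset G _ h_fin] with ω hω
      rw [hω]
  filter_upwards [(ae_ball_iff (G.map φ).range.countable_toSet).2 fun c _ => h_fiber c] with ω hω
  rw [simpleStableIntegral, Finset.sum_congr rfl hω, SimpleFunc.range_map,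
    ← Finset.sum_fiberwise_of_maps_to (g := φ) fun b hb => Finset.mem_image_of_mem φ hb]
  refine Finset.sum_congr rfl fun c _ => ?_
  rw [Finset.mul_sum]
  exact Finset.sum_congr rfl fun b hb => by rw [(Finset.mem_filter.1 hb).2]

lemma ae_simpleStableIntegral_add (hΛ : IsSaSRandomMeasure P α Λ) {F G : SimpleFunc ℝ ℝ}
    (hF : F.FinMeasSupp volume) (hG : G.FinMeasSupp volume) :
    simpleStableIntegral Λ (F + G) =ᵐ[P] simpleStableIntegral Λ F + simpleStableIntegral Λ G := by
  filter_upwards [hΛ.ae_simpleStableIntegral_map (F.pair G) Prod.fst hF,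
    hΛ.ae_simpleStableIntegral_map (F.pair G) Prod.snd hG,
    hΛ.ae_simpleStableIntegral_map (F.pair G) (fun z => z.1 + z.2) (hF.add hG)] with ω hFω hGω hω
  calc simpleStableIntegral Λ (F + G) ω
      = ∑ z ∈ (F.pair G).range, (z.1 + z.2) * Λ (F.pair G ⁻¹' {z}) ω := hω
    _ = simpleStableIntegral Λ ((F.pair G).map Prod.fst) ω +
          simpleStableIntegral Λ ((F.pair G).map Prod.snd) ω := by
        simp only [hFω, hGω, add_mul, Finset.sum_add_distrib]

lemma ae_simpleStableIntegral_const_smul (hΛ : IsSaSRandomMeasure P α Λ) {F : SimpleFunc ℝ ℝ}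
    (hF : F.FinMeasSupp volume) (c : ℝ) :
    simpleStableIntegral Λ (F.map (c * ·)) =ᵐ[P] c • simpleStableIntegral Λ F := by
  filter_upwards [hΛ.ae_simpleStableIntegral_map F (c * ·) (hF.map (mul_zero c))] with ω hω
  rw [hω]
  simp only [Pi.smul_apply, smul_eq_mul, simpleStableIntegral, Finset.mul_sum, mul_assoc]

lemma measurable_simpleStableIntegral (hΛ : IsSaSRandomMeasure P α Λ) {F : SimpleFunc ℝ ℝ}
    (hF : F.FinMeasSupp volume) : Measurable (simpleStableIntegral Λ F) := by
  refine Finset.measurable_sum _ fun c _ => ?_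
  rcases eq_or_ne c 0 with rfl | hc
  · simp
  · exact (hΛ.measurable _ (F.measurableSet_preimage _)
      (hF.meas_preimage_singleton_ne_zero hc)).const_mul c

lemma iIndepFun_preimage_singleton (hΛ : IsSaSRandomMeasure P α Λ) {β : Type*}
    (G : SimpleFunc ℝ β) (S : Finset β) (hS : ∀ b : S, volume (G ⁻¹' {(b : β)}) < ⊤) :
    iIndepFun (fun b : S => Λ (G ⁻¹' {(b : β)})) P := by
  let e := Fintype.equivFin S
  have h_indep := hΛ.indep _ (fun i => G ⁻¹' {((e.symm i : S) : β)})
    (fun i => G.measurableSet_preimage _) (fun i => hS _)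
    fun i j hij => Disjoint.preimage _ (by simpa [Subtype.val_inj] using hij)
  simpa using h_indep.precomp e.injective

lemma charFun_map_simpleStableIntegral [IsProbabilityMeasure P] (hΛ : IsSaSRandomMeasure P α Λ)
    (hα : 0 < α) {F : SimpleFunc ℝ ℝ} (hF : F.FinMeasSupp volume) (s : ℝ) :
    charFun (P.map (simpleStableIntegral Λ F)) s =
      ((Real.exp (-(|s| ^ α * ∫ x, |F x| ^ α)) : ℝ) : ℂ) := by
  classical
  set S : Finset ℝ := F.range.filter (· ≠ 0) with hS_def
  have hS_fin (c : S) : volume (F ⁻¹' {(c : ℝ)}) < ⊤ :=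
    hF.meas_preimage_singleton_ne_zero (Finset.mem_filter.1 c.2).2
  have hS_meas (c : S) : Measurable (Λ (F ⁻¹' {(c : ℝ)})) :=
    hΛ.measurable _ (F.measurableSet_preimage _) (hS_fin c)
  have h_sum : simpleStableIntegral Λ F = fun ω => ∑ c : S, c * Λ (F ⁻¹' {(c : ℝ)}) ω := by
    ext ω
    rw [Finset.sum_coe_sort S fun c => c * Λ (F ⁻¹' {c}) ω, simpleStableIntegral, hS_def,
      Finset.sum_filter_of_ne fun x _ hx => left_ne_zero_of_mul hx]
  have h_integral : ∫ x, |F x| ^ α = ∑ c : S, volume.real (F ⁻¹' {(c : ℝ)}) * |(c : ℝ)| ^ α := by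
    rw [integral_comp_simpleFunc_eq_sum (SimpleFunc.integrable_iff_finMeasSupp.2 hF)
      (g := fun c => |c| ^ α) (by simp [hα.ne'])]
    exact (Finset.sum_coe_sort S fun c => volume.real (F ⁻¹' {c}) * |c| ^ α).symm
  have h_indep : iIndepFun (fun (c : S) ω => c * Λ (F ⁻¹' {(c : ℝ)}) ω) P :=
    (hΛ.iIndepFun_preimage_singleton F S hS_fin).comp (fun c x => c * x) fun c => by fun_prop
  rw [h_sum, h_indep.charFun_map_fun_sum_eq_prod fun c => ((hS_meas c).const_mul _).aemeasurable,
    h_integral, Finset.prod_apply, Finset.mul_sum, ← Finset.sum_neg_distrib, Real.exp_sum,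
    Complex.ofReal_prod]
  refine Finset.prod_congr rfl fun c _ => ?_
  rw [charFun_map_mul_comp (hS_meas c).aemeasurable,
    hΛ.charFun_eq _ (F.measurableSet_preimage _) (hS_fin c), abs_mul,
    Real.mul_rpow (abs_nonneg _) (abs_nonneg _), Measure.real]
  ring_nf

end IsSaSRandomMeasure

end RandomMeasure

section CharacteristicFunction

variable {Ω Ω' : Type*} [MeasurableSpace Ω] [MeasurableSpace Ω'] {P : Measure Ω}
  {P' : Measure Ω'} [IsFiniteMeasure P]

lemma integral_cos_mul_eq_re_charFun {Y : Ω → ℝ} (hY : AEMeasurable Y P) (t : ℝ) :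
    ∫ ω, Real.cos (t * Y ω) ∂P = (charFun (P.map Y) t).re := by
  have h_int : Integrable (fun ω => Complex.exp (t * Y ω * Complex.I)) P := by
    refine .of_bound (by fun_prop) 1 (Eventually.of_forall fun ω => ?_)
    exact_mod_cast (Complex.norm_exp_ofReal_mul_I (t * Y ω)).le
  rw [charFun_apply_real, integral_map hY (by fun_prop), ← RCLike.re_eq_complex_re,
    ← integral_re h_int]
  exact integral_congr_ae (Eventually.of_forall fun ω => by
    simpa using (Complex.exp_ofReal_mul_I_re (t * Y ω)).symm)

lemma identDistrib_pi_of_forall_sum_mul [IsFiniteMeasure P'] {ι : Type*} [Fintype ι]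
    {X : ι → Ω → ℝ} {Y : ι → Ω' → ℝ} (hX : ∀ i, AEMeasurable (X i) P)
    (hY : ∀ i, AEMeasurable (Y i) P')
    (h : ∀ c : ι → ℝ,
      IdentDistrib (fun ω => ∑ i, c i * X i ω) (fun ω => ∑ i, c i * Y i ω) P P') :
    IdentDistrib (fun ω i => X i ω) (fun ω i => Y i ω) P P' := by
  classical
  have hX_pi : AEMeasurable (fun ω i => X i ω) P := aemeasurable_pi_lambda _ hX
  have hY_pi : AEMeasurable (fun ω i => Y i ω) P' := aemeasurable_pi_lambda _ hY
  refine ⟨hX_pi, hY_pi, Measure.ext_of_charFunDual (funext fun L => ?_)⟩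
  have h_coord (x : ι → ℝ) : L x = ∑ i, L (fun j => if i = j then 1 else 0) * x i := by
    simpa [mul_comm] using LinearMap.pi_apply_eq_sum_univ L.toLinearMap x
  rw [charFunDual_eq_charFun_map_one, charFunDual_eq_charFun_map_one,
    AEMeasurable.map_map_of_aemeasurable (by fun_prop) hX_pi,
    AEMeasurable.map_map_of_aemeasurable (by fun_prop) hY_pi]
  simpa only [Function.comp_def, h_coord (fun i => X i _), h_coord (fun i => Y i _)] using
    congrArg (charFun · 1) (h fun i => L (fun j => if i = j then 1 else 0)).map_eq

end CharacteristicFunction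

section StableIntegral

variable {Ω : Type*} [MeasurableSpace Ω] {P : Measure Ω} {α : ℝ} {Λ : Set ℝ → Ω → ℝ}
  {f g : ℝ → ℝ} {Y Z : Ω → ℝ}

namespace IsStableIntegral

lemma zero : IsStableIntegral P α Λ 0 0 := by
  have h_zero : simpleStableIntegral Λ 0 = 0 := by
    ext ω
    simp [simpleStableIntegral]
  refine ⟨fun _ => 0, fun _ => SimpleFunc.finMeasSupp_iff_support.2 (by simp), by simp, ?_⟩
  intro ε hε
  simp [h_zero, hε.not_ge]

lemma add (hΛ : IsSaSRandomMeasure P α Λ) (hf : AEStronglyMeasurable f volume)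
    (hg : AEStronglyMeasurable g volume) (hY : IsStableIntegral P α Λ f Y)
    (hZ : IsStableIntegral P α Λ g Z) : IsStableIntegral P α Λ (f + g) (Y + Z) := by
  obtain ⟨F, hF, hFf, hFY⟩ := hY
  obtain ⟨G, hG, hGg, hGZ⟩ := hZ
  refine ⟨fun n => F n + G n, fun n => (hF n).add (hG n), ?_,
    (tendstoInMeasure_add hFY hGZ).congr_left fun n =>
      (hΛ.ae_simpleStableIntegral_add (hF n) (hG n)).symm⟩
  refine (tendsto_eLpNorm_add_zero (fun n => (F n).aestronglyMeasurable.sub hf)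
    (fun n => (G n).aestronglyMeasurable.sub hg) hFf hGg).congr fun n => ?_
  congr 1
  ext x
  simp [add_sub_add_comm]

lemma const_smul (hΛ : IsSaSRandomMeasure P α Λ) (hY : IsStableIntegral P α Λ f Y) (c : ℝ) :
    IsStableIntegral P α Λ (c • f) (c • Y) := by
  obtain ⟨F, hF, hFf, hFY⟩ := hY
  refine ⟨fun n => (F n).map (c * ·), fun n => (hF n).map (mul_zero c), ?_,
    (tendstoInMeasure_const_smul hFY c).congr_left fun n =>
      (hΛ.ae_simpleStableIntegral_const_smul (hF n) c).symm⟩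
  have h_smul := ENNReal.Tendsto.const_mul hFf (Or.inr (enorm_ne_top (x := c)))
  rw [mul_zero] at h_smul
  refine h_smul.congr fun n => ?_
  rw [← eLpNorm_const_smul]
  congr 1
  ext x
  simp [mul_sub]

lemma sum (hΛ : IsSaSRandomMeasure P α Λ) {ι : Type*} (s : Finset ι) {f : ι → ℝ → ℝ}
    {Y : ι → Ω → ℝ} (hf : ∀ i, AEStronglyMeasurable (f i) volume)
    (hY : ∀ i, IsStableIntegral P α Λ (f i) (Y i)) :
    IsStableIntegral P α Λ (∑ i ∈ s, f i) (∑ i ∈ s, Y i) := by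
  classical
  induction s using Finset.induction_on with
  | empty => simpa using zero
  | insert a s ha ih =>
    simpa only [Finset.sum_insert ha] using
      add hΛ (hf a) (s.aestronglyMeasurable_sum fun i _ => hf i) (hY a) ih

lemma sub (hΛ : IsSaSRandomMeasure P α Λ) (hf : AEStronglyMeasurable f volume)
    (hg : AEStronglyMeasurable g volume) (hY : IsStableIntegral P α Λ f Y)
    (hZ : IsStableIntegral P α Λ g Z) : IsStableIntegral P α Λ (f - g) (Y - Z) := by
  simpa [sub_eq_add_neg] using hY.add hΛ hf (hg.const_smul (-1 : ℝ)) (hZ.const_smul hΛ (-1))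

lemma aemeasurable (hΛ : IsSaSRandomMeasure P α Λ) (hY : IsStableIntegral P α Λ f Y) :
    AEMeasurable Y P := by
  obtain ⟨F, hF, -, hFY⟩ := hY
  exact hFY.aemeasurable fun n => (hΛ.measurable_simpleStableIntegral (hF n)).aemeasurable

variable [IsProbabilityMeasure P]

lemma charFun_map (hα : 0 < α) (hΛ : IsSaSRandomMeasure P α Λ)
    (hf : MemLp f (ENNReal.ofReal α) volume) (hY : IsStableIntegral P α Λ f Y) (s : ℝ) :
    charFun (P.map Y) s = ((Real.exp (-(|s| ^ α * ∫ x, |f x| ^ α)) : ℝ) : ℂ) := by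
  obtain ⟨F, hF, hFf, hFY⟩ := hY
  have h_law := (hFY.tendstoInDistribution fun n =>
    (hΛ.measurable_simpleStableIntegral (hF n)).aemeasurable).tendsto
  have h_charFun := ProbabilityMeasure.tendsto_iff_tendsto_charFun.1 h_law s
  have h_integral : Tendsto (fun n => ∫ x, |F n x| ^ α) atTop (𝓝 (∫ x, |f x| ^ α)) :=
    tendsto_integral_norm_rpow_of_tendsto_eLpNorm_sub hα
      (fun n => (F n).measurable.aestronglyMeasurable) hf hFf
  have h_cont : Continuous fun y : ℝ => ((Real.exp (-(|s| ^ α * y)) : ℝ) : ℂ) := by fun_prop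
  refine tendsto_nhds_unique h_charFun (((h_cont.tendsto _).comp h_integral).congr fun n => ?_)
  exact (hΛ.charFun_map_simpleStableIntegral hα (hF n) s).symm

lemma identDistrib (hα : 0 < α) (hΛ : IsSaSRandomMeasure P α Λ)
    (hf : MemLp f (ENNReal.ofReal α) volume) (hg : MemLp g (ENNReal.ofReal α) volume)
    (hY : IsStableIntegral P α Λ f Y) (hZ : IsStableIntegral P α Λ g Z)
    (hfg : ∫ x, |f x| ^ α = ∫ x, |g x| ^ α) : IdentDistrib Y Z P P := by
  refine ⟨hY.aemeasurable hΛ, hZ.aemeasurable hΛ, Measure.ext_of_charFun (funext fun s => ?_)⟩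
  rw [hY.charFun_map hα hΛ hf, hZ.charFun_map hα hΛ hg, hfg]

lemma integral_cos (hα : 0 < α) (hΛ : IsSaSRandomMeasure P α Λ)
    (hf : MemLp f (ENNReal.ofReal α) volume) (hY : IsStableIntegral P α Λ f Y) :
    ∫ ω, Real.cos (Y ω) ∂P = Real.exp (-∫ x, |f x| ^ α) := by
  simpa [hY.charFun_map hα hΛ hf, -Complex.ofReal_exp] using
    integral_cos_mul_eq_re_charFun (hY.aemeasurable hΛ) 1

end IsStableIntegral

namespace IsSaSMovingAverage

variable {m : ℝ → ℝ} {X : ℝ → Ω → ℝ}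

lemma memLp_kernel_sub_left (hX : IsSaSMovingAverage P α m X) (t : ℝ) :
    MemLp (fun x => m (t - x)) (ENNReal.ofReal α) volume :=
  hX.memLp_kernel.comp_measurePreserving (Measure.measurePreserving_sub_left volume t)

lemma isStationaryProcess [IsProbabilityMeasure P] (hα : 0 < α)
    (hX : IsSaSMovingAverage P α m X) : IsStationaryProcess P X := by
  intro n t h
  obtain ⟨Λ, hΛ, hX_int⟩ := hX.exists_integral
  refine identDistrib_pi_of_forall_sum_mul (fun i => (hX.measurable _).aemeasurable)
    (fun i => (hX.measurable _).aemeasurable) fun c => ?_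
  have h_memLp (τ : Fin n → ℝ) :
      MemLp (∑ i, c i • fun x => m (τ i - x)) (ENNReal.ofReal α) volume :=
    memLp_finsetSum' _ fun i _ => (hX.memLp_kernel_sub_left (τ i)).const_smul (c i)
  have h_stable (τ : Fin n → ℝ) :
      IsStableIntegral P α Λ (∑ i, c i • fun x => m (τ i - x)) (∑ i, c i • X (τ i)) :=
    .sum hΛ _ (fun i => ((hX.memLp_kernel_sub_left (τ i)).const_smul (c i)).1)
      fun i => (hX_int (τ i)).const_smul hΛ (c i)
  have h_translate : ∫ x, |(∑ i, c i • fun x => m (t i + h - x)) x| ^ α =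
      ∫ x, |(∑ i, c i • fun x => m (t i - x)) x| ^ α := by
    rw [← integral_add_right_eq_self _ h]
    simp
  simpa [Finset.sum_fn] using (h_stable fun i => t i + h).identDistrib hα hΛ
    (h_memLp _) (h_memLp _) (h_stable t) h_translate

end IsSaSMovingAverage

end StableIntegral

section ClarksonDefect

lemma add_rpow_le_rpow_add_mul_rpow {β x y : ℝ} (hβ0 : 0 < β) (hβ1 : β ≤ 1) (hy : 0 ≤ y)
    (hyx : y ≤ x) : (x + y) ^ β ≤ x ^ β + β * y ^ β := by
  rcases (hy.trans hyx).eq_or_lt with rfl | hx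
  · simp [hyx.antisymm hy, Real.zero_rpow hβ0.ne']
  have hr0 : 0 ≤ y / x := by positivity
  have h_ratio : y / x ≤ (y / x) ^ β :=
    Real.self_le_rpow_of_le_one hr0 ((div_le_one hx).2 hyx) hβ1
  calc (x + y) ^ β = x ^ β * (1 + y / x) ^ β := by
        rw [← Real.mul_rpow hx.le (by positivity)]
        congr 1
        field_simp
    _ ≤ x ^ β * (1 + β * (y / x)) := by
        gcongr
        exact rpow_one_add_le_one_add_mul_self (by linarith) hβ0.le hβ1
    _ ≤ x ^ β * (1 + β * (y / x) ^ β) := by gcongr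
    _ = x ^ β + β * (x * (y / x)) ^ β := by
        rw [Real.mul_rpow hx.le hr0]
        ring
    _ = x ^ β + β * y ^ β := by rw [mul_div_cancel₀ _ hx.ne']

variable {E : Type*} [NormedAddCommGroup E] [InnerProductSpace ℝ E] {α : ℝ}

lemma rpow_eq_sq_rpow_half {x : ℝ} (hx : 0 ≤ x) (α : ℝ) : x ^ α = (x ^ 2) ^ (α / 2) := by
  rw [← Real.rpow_natCast_mul hx]
  congr 1
  push_cast
  ring

lemma norm_add_rpow_add_norm_sub_rpow_le (hα0 : 0 ≤ α) (hα2 : α ≤ 2) (a b : E) :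
    ‖a + b‖ ^ α + ‖a - b‖ ^ α ≤ 2 * (‖a‖ ^ 2 + ‖b‖ ^ 2) ^ (α / 2) := by
  have h_concave (x y : ℝ) (hx : 0 ≤ x) (hy : 0 ≤ y) :
      1 / 2 * x ^ (α / 2) + 1 / 2 * y ^ (α / 2) ≤ (1 / 2 * x + 1 / 2 * y) ^ (α / 2) := by
    simpa using (Real.concaveOn_rpow (p := α / 2) (by linarith) (by linarith)).2 hx hy
      (by norm_num : (0 : ℝ) ≤ 1 / 2) (by norm_num : (0 : ℝ) ≤ 1 / 2) (by norm_num)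
  have h_parallelogram : 1 / 2 * ‖a + b‖ ^ 2 + 1 / 2 * ‖a - b‖ ^ 2 = ‖a‖ ^ 2 + ‖b‖ ^ 2 := by
    linarith [parallelogram_law_with_norm ℝ a b]
  have h := h_concave (‖a + b‖ ^ 2) (‖a - b‖ ^ 2) (sq_nonneg _) (sq_nonneg _)
  rw [h_parallelogram, ← rpow_eq_sq_rpow_half (norm_nonneg _),
    ← rpow_eq_sq_rpow_half (norm_nonneg _)] at h
  linarith

lemma norm_add_rpow_add_norm_sub_rpow_add_min_le (hα0 : 0 < α) (hα2 : α ≤ 2) (a b : E) :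
    ‖a + b‖ ^ α + ‖a - b‖ ^ α + (2 - α) * min (‖a‖ ^ α) (‖b‖ ^ α) ≤
      2 * (‖a‖ ^ α + ‖b‖ ^ α) := by
  wlog hba : ‖b‖ ≤ ‖a‖ generalizing a b
  · simpa only [add_comm b a, norm_sub_rev b a, min_comm, add_comm (‖b‖ ^ α)] using
      this b a (le_of_not_ge hba)
  rw [min_eq_right (by gcongr)]
  have h_tangent : (‖a‖ ^ 2 + ‖b‖ ^ 2) ^ (α / 2) ≤ ‖a‖ ^ α + α / 2 * ‖b‖ ^ α := by
    rw [rpow_eq_sq_rpow_half (norm_nonneg a), rpow_eq_sq_rpow_half (norm_nonneg b)]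
    exact add_rpow_le_rpow_add_mul_rpow (by linarith) (by linarith) (by positivity) (by gcongr)
  linarith [norm_add_rpow_add_norm_sub_rpow_le hα0.le hα2 a b]

variable {𝓧 : Type*} [MeasurableSpace 𝓧] {μ : Measure 𝓧}

lemma integral_norm_add_rpow_add_integral_norm_sub_rpow_add_min_le (hα0 : 0 < α) (hα2 : α ≤ 2)
    {f g : 𝓧 → E} (hf : MemLp f (ENNReal.ofReal α) μ) (hg : MemLp g (ENNReal.ofReal α) μ) :
    (∫ x, ‖f x + g x‖ ^ α ∂μ) + (∫ x, ‖f x - g x‖ ^ α ∂μ) +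
        (2 - α) * ∫ x, min (‖f x‖ ^ α) (‖g x‖ ^ α) ∂μ ≤
      2 * ((∫ x, ‖f x‖ ^ α ∂μ) + ∫ x, ‖g x‖ ^ α ∂μ) := by
  have hf_int := integrable_norm_rpow_of_memLp hα0 hf
  have hg_int := integrable_norm_rpow_of_memLp hα0 hg
  have h_add : Integrable (fun x => ‖f x + g x‖ ^ α) μ :=
    integrable_norm_rpow_of_memLp hα0 (hf.add hg)
  have h_sub : Integrable (fun x => ‖f x - g x‖ ^ α) μ :=
    integrable_norm_rpow_of_memLp hα0 (hf.sub hg)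
  have h_min : Integrable (fun x => (2 - α) * min (‖f x‖ ^ α) (‖g x‖ ^ α)) μ :=
    (hf_int.inf hg_int).const_mul (2 - α)
  have h_add_sub : Integrable (fun x => ‖f x + g x‖ ^ α + ‖f x - g x‖ ^ α) μ := h_add.add h_sub
  calc (∫ x, ‖f x + g x‖ ^ α ∂μ) + (∫ x, ‖f x - g x‖ ^ α ∂μ) +
        (2 - α) * ∫ x, min (‖f x‖ ^ α) (‖g x‖ ^ α) ∂μ
      = ∫ x, ‖f x + g x‖ ^ α + ‖f x - g x‖ ^ α + (2 - α) * min (‖f x‖ ^ α) (‖g x‖ ^ α) ∂μ := by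
        rw [← integral_const_mul, integral_add h_add_sub h_min, integral_add h_add h_sub]
    _ ≤ ∫ x, 2 * (‖f x‖ ^ α + ‖g x‖ ^ α) ∂μ :=
        integral_mono (h_add_sub.add h_min) ((hf_int.add hg_int).const_mul 2)
          fun x => norm_add_rpow_add_norm_sub_rpow_add_min_le hα0 hα2 (f x) (g x)
    _ = 2 * ((∫ x, ‖f x‖ ^ α ∂μ) + ∫ x, ‖g x‖ ^ α ∂μ) := by
        rw [integral_const_mul, integral_add hf_int hg_int]

end ClarksonDefect

section CovarianceCos

variable {Ω : Type*} [MeasurableSpace Ω] {P : Measure Ω} {Y Z : Ω → ℝ}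

lemma memLp_cos [IsFiniteMeasure P] (hY : AEMeasurable Y P) (p : ENNReal) :
    MemLp (fun ω => Real.cos (Y ω)) p P :=
  .of_bound (by fun_prop) 1 (Eventually.of_forall fun ω => Real.abs_cos_le_one (Y ω))

variable [IsProbabilityMeasure P]

lemma covariance_cos_cos (hY : AEMeasurable Y P) (hZ : AEMeasurable Z P) :
    cov[fun ω => Real.cos (Y ω), fun ω => Real.cos (Z ω); P] =
      ((∫ ω, Real.cos (Y ω + Z ω) ∂P) + ∫ ω, Real.cos (Y ω - Z ω) ∂P) / 2 -
        (∫ ω, Real.cos (Y ω) ∂P) * ∫ ω, Real.cos (Z ω) ∂P := by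
  have h_add : Integrable (fun ω => Real.cos (Y ω + Z ω)) P :=
    (memLp_cos (hY.add hZ) 1).integrable le_rfl
  have h_sub : Integrable (fun ω => Real.cos (Y ω - Z ω)) P :=
    (memLp_cos (hY.sub hZ) 1).integrable le_rfl
  have h_prod (ω : Ω) : Real.cos (Y ω) * Real.cos (Z ω) =
      (Real.cos (Y ω + Z ω) + Real.cos (Y ω - Z ω)) / 2 := by
    rw [Real.cos_add, Real.cos_sub]
    ring
  rw [covariance_eq_sub (memLp_cos hY 2) (memLp_cos hZ 2)]
  simp only [Pi.mul_apply, h_prod]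
  rw [integral_div, integral_add h_add h_sub]

namespace IsStableIntegral

variable {α : ℝ} {Λ : Set ℝ → Ω → ℝ} {f g : ℝ → ℝ}

lemma covariance_cos_cos (hα : 0 < α) (hΛ : IsSaSRandomMeasure P α Λ)
    (hf : MemLp f (ENNReal.ofReal α) volume) (hg : MemLp g (ENNReal.ofReal α) volume)
    (hY : IsStableIntegral P α Λ f Y) (hZ : IsStableIntegral P α Λ g Z) :
    cov[fun ω => Real.cos (Y ω), fun ω => Real.cos (Z ω); P] =
      (Real.exp (-∫ x, |f x + g x| ^ α) + Real.exp (-∫ x, |f x - g x| ^ α)) / 2 -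
        Real.exp (-((∫ x, |f x| ^ α) + ∫ x, |g x| ^ α)) := by
  have h_add := (hY.add hΛ hf.1 hg.1 hZ).integral_cos hα hΛ (hf.add hg)
  have h_sub := (hY.sub hΛ hf.1 hg.1 hZ).integral_cos hα hΛ (hf.sub hg)
  simp only [Pi.add_apply, Pi.sub_apply] at h_add h_sub
  rw [_root_.covariance_cos_cos (hY.aemeasurable hΛ) (hZ.aemeasurable hΛ), h_add, h_sub,
    hY.integral_cos hα hΛ hf, hZ.integral_cos hα hΛ hg, neg_add, Real.exp_add]

lemma exp_neg_mul_integral_min_le_covariance_cos_cos (hα0 : 0 < α) (hα2 : α ≤ 2)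
    (hΛ : IsSaSRandomMeasure P α Λ)
    (hf : MemLp f (ENNReal.ofReal α) volume) (hg : MemLp g (ENNReal.ofReal α) volume)
    (hY : IsStableIntegral P α Λ f Y) (hZ : IsStableIntegral P α Λ g Z) :
    Real.exp (-((∫ x, |f x| ^ α) + ∫ x, |g x| ^ α)) *
        ((2 - α) / 2 * ∫ x, min (|f x| ^ α) (|g x| ^ α)) ≤
      cov[fun ω => Real.cos (Y ω), fun ω => Real.cos (Z ω); P] := by
  have h_defect := integral_norm_add_rpow_add_integral_norm_sub_rpow_add_min_le hα0 hα2 hf hg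
  simp only [Real.norm_eq_abs] at h_defect
  rw [hY.covariance_cos_cos hα0 hΛ hf hg hZ]
  set A := ∫ x, |f x + g x| ^ α
  set B := ∫ x, |f x - g x| ^ α
  set C := (∫ x, |f x| ^ α) + ∫ x, |g x| ^ α
  have h_tangent (a : ℝ) : Real.exp (-C) * (1 + (C - a)) ≤ Real.exp (-a) := by
    calc Real.exp (-C) * (1 + (C - a)) ≤ Real.exp (-C) * Real.exp (C - a) := by
          gcongr
          linarith [Real.add_one_le_exp (C - a)]
      _ = Real.exp (-a) := by rw [← Real.exp_add]; ring_nf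
  calc Real.exp (-C) * ((2 - α) / 2 * ∫ x, min (|f x| ^ α) (|g x| ^ α))
      ≤ Real.exp (-C) * (C - (A + B) / 2) := by gcongr; linarith
    _ ≤ (Real.exp (-A) + Real.exp (-B)) / 2 - Real.exp (-C) := by
        linarith [h_tangent A, h_tangent B]

end IsStableIntegral

end CovarianceCos

section CovarianceMixture

variable {Ω S T : Type*} [MeasurableSpace Ω] [MeasurableSpace S] [MeasurableSpace T]
  {P : Measure Ω} {ν : Measure S} {τ : Measure T}
  {φ : S → Ω → ℝ} {ψ : T → Ω → ℝ} {a : S → ℝ} {b : T → ℝ} {Z : Ω → ℝ}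

lemma integrable_prod_mul_of_abs_le [SFinite P] (hφ : Measurable (Function.uncurry φ))
    (ha : Integrable a ν) (hφa : ∀ s ω, |φ s ω| ≤ a s) (hZ : Integrable Z P) :
    Integrable (fun z : S × Ω => φ z.1 z.2 * Z z.2) (ν.prod P) := by
  refine (ha.mul_prod hZ.norm).mono' (hφ.aestronglyMeasurable.mul hZ.1.comp_snd)
    (Eventually.of_forall fun z => ?_)
  simp only [norm_mul, Real.norm_eq_abs]
  gcongr
  exact hφa z.1 z.2

lemma memLp_of_abs_le [IsFiniteMeasure P] (hφ : Measurable (Function.uncurry φ))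
    (hφa : ∀ s ω, |φ s ω| ≤ a s) (s : S) (p : ENNReal) : MemLp (φ s) p P :=
  .of_bound hφ.of_uncurry_left.aestronglyMeasurable (a s) (Eventually.of_forall (hφa s))

lemma memLp_integral_of_abs_le [IsFiniteMeasure P] [SFinite ν]
    (hφ : Measurable (Function.uncurry φ)) (ha : Integrable a ν) (hφa : ∀ s ω, |φ s ω| ≤ a s)
    (p : ENNReal) : MemLp (fun ω => ∫ s, φ s ω ∂ν) p P :=
  .of_bound hφ.stronglyMeasurable.integral_prod_left'.aestronglyMeasurable (∫ s, a s ∂ν)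
    (Eventually.of_forall fun ω =>
      norm_integral_le_of_norm_le ha (Eventually.of_forall fun s => hφa s ω))

variable [IsProbabilityMeasure P]

lemma covariance_eq_integral_mul_sub {A : Ω → ℝ} (hA : MemLp A 2 P) (hZ : MemLp Z 2 P) :
    cov[A, Z; P] = ∫ ω, A ω * (Z ω - P[Z]) ∂P := by
  have h_centered : ∫ ω, Z ω - P[Z] ∂P = 0 := by
    rw [integral_sub (hZ.integrable one_le_two) (integrable_const _)]
    simp
  have hZ_sub : MemLp (fun ω => Z ω - P[Z]) 2 P := hZ.sub (memLp_const _)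
  rw [← covariance_sub_const_right (hZ.integrable one_le_two) P[Z],
    covariance_eq_sub hA hZ_sub, h_centered, mul_zero, sub_zero]
  rfl

lemma integrable_covariance_left (hφ : Measurable (Function.uncurry φ)) (ha : Integrable a ν)
    (hφa : ∀ s ω, |φ s ω| ≤ a s) (hZ : MemLp Z 2 P) :
    Integrable (fun s => cov[φ s, Z; P]) ν := by
  simp only [covariance_eq_integral_mul_sub (memLp_of_abs_le hφ hφa _ 2) hZ]
  exact (integrable_prod_mul_of_abs_le hφ ha hφa
    ((hZ.integrable one_le_two).sub (integrable_const _))).integral_prod_left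

variable [SFinite ν]

lemma integral_covariance_left (hφ : Measurable (Function.uncurry φ)) (ha : Integrable a ν)
    (hφa : ∀ s ω, |φ s ω| ≤ a s) (hZ : MemLp Z 2 P) :
    ∫ s, cov[φ s, Z; P] ∂ν = cov[fun ω => ∫ s, φ s ω ∂ν, Z; P] := by
  simp only [covariance_eq_integral_mul_sub (memLp_of_abs_le hφ hφa _ 2) hZ]
  rw [covariance_eq_integral_mul_sub (memLp_integral_of_abs_le hφ ha hφa 2) hZ,
    integral_integral_swap (integrable_prod_mul_of_abs_le hφ ha hφa
      ((hZ.integrable one_le_two).sub (integrable_const _)))]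
  simp only [integral_mul_const]

lemma integrable_integral_covariance (hφ : Measurable (Function.uncurry φ)) (ha : Integrable a ν)
    (hφa : ∀ s ω, |φ s ω| ≤ a s) (hψ : Measurable (Function.uncurry ψ)) (hb : Integrable b τ)
    (hψb : ∀ t ω, |ψ t ω| ≤ b t) : Integrable (fun t => ∫ s, cov[φ s, ψ t; P] ∂ν) τ := by
  simp only [integral_covariance_left hφ ha hφa (memLp_of_abs_le hψ hψb _ 2),
    covariance_comm (fun ω => ∫ s, φ s ω ∂ν)]
  exact integrable_covariance_left hψ hb hψb (memLp_integral_of_abs_le hφ ha hφa 2)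

lemma integral_integral_covariance [SFinite τ] (hφ : Measurable (Function.uncurry φ))
    (ha : Integrable a ν) (hφa : ∀ s ω, |φ s ω| ≤ a s) (hψ : Measurable (Function.uncurry ψ))
    (hb : Integrable b τ) (hψb : ∀ t ω, |ψ t ω| ≤ b t) :
    ∫ t, ∫ s, cov[φ s, ψ t; P] ∂ν ∂τ =
      cov[fun ω => ∫ s, φ s ω ∂ν, fun ω => ∫ t, ψ t ω ∂τ; P] := by
  simp only [integral_covariance_left hφ ha hφa (memLp_of_abs_le hψ hψb _ 2),
    covariance_comm (fun ω => ∫ s, φ s ω ∂ν)]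
  exact integral_covariance_left hψ hb hψb (memLp_integral_of_abs_le hφ ha hφa 2)

lemma integral_mul_integral_mul_le_covariance_integral [SFinite τ]
    (hφ : Measurable (Function.uncurry φ)) (ha : Integrable a ν) (hφa : ∀ s ω, |φ s ω| ≤ a s)
    (hψ : Measurable (Function.uncurry ψ)) (hb : Integrable b τ) (hψb : ∀ t ω, |ψ t ω| ≤ b t)
    {w : S → ℝ} {z : T → ℝ} {c : ℝ} (hw : Integrable w ν) (hz : Integrable z τ)
    (h : ∀ s t, w s * (z t * c) ≤ cov[φ s, ψ t; P]) :
    (∫ s, w s ∂ν) * ((∫ t, z t ∂τ) * c) ≤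
      cov[fun ω => ∫ s, φ s ω ∂ν, fun ω => ∫ t, ψ t ω ∂τ; P] := by
  rw [← integral_integral_covariance hφ ha hφa hψ hb hψb, ← integral_mul_const (r := c),
    ← integral_const_mul]
  refine integral_mono ((hz.mul_const c).const_mul _)
    (integrable_integral_covariance hφ ha hφa hψ hb hψb) fun t => ?_
  simp only [← integral_mul_const]
  exact integral_mono (hw.mul_const _)
    (integrable_covariance_left hφ ha hφa (memLp_of_abs_le hψ hψb t 2)) fun s => h s t

end CovarianceMixture

section Hoeffding

variable {Ω : Type*} [MeasurableSpace Ω] {P : Measure Ω} [IsProbabilityMeasure P] {X Y : Ω → ℝ}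
  {ν : Measure ℝ} [SFinite ν] {g k : ℝ → ℝ}

lemma covariance_setIntegral_Iio (hX : Measurable X) (hY : Measurable Y) (hg : Measurable g)
    (hg_int : Integrable g ν) (hk : Measurable k) (hk_int : Integrable k ν) :
    cov[fun ω => ∫ u in Set.Iio (X ω), g u ∂ν, fun ω => ∫ v in Set.Iio (Y ω), k v ∂ν; P] =
      ∫ v, ∫ u, g u * k v * cov[{ω | u < X ω}.indicator (fun _ => (1 : ℝ)),
        {ω | v < Y ω}.indicator (fun _ => (1 : ℝ)); P] ∂ν ∂ν := by
  have h_meas {f : ℝ → ℝ} (hf : Measurable f) {W : Ω → ℝ} (hW : Measurable W) :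
      Measurable (Function.uncurry fun u => f u • {ω | u < W ω}.indicator fun _ => (1 : ℝ)) :=
    (hf.comp measurable_fst).mul (measurable_const.indicator
      (measurableSet_lt measurable_fst (hW.comp measurable_snd)) : Measurable
        ({z : ℝ × Ω | z.1 < W z.2}.indicator fun _ => (1 : ℝ)))
  have h_le (f : ℝ → ℝ) (W : Ω → ℝ) (u : ℝ) (ω : Ω) :
      |(f u • {ω | u < W ω}.indicator fun _ => (1 : ℝ)) ω| ≤ |f u| := by
    by_cases hu : u < W ω <;> simp [hu]
  have h_integral (f : ℝ → ℝ) (W : Ω → ℝ) (ω : Ω) :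
      ∫ u, (f u • {ω | u < W ω}.indicator fun _ => (1 : ℝ)) ω ∂ν =
        ∫ u in Set.Iio (W ω), f u ∂ν := by
    rw [← integral_indicator measurableSet_Iio]
    refine integral_congr_ae (Eventually.of_forall fun u => ?_)
    by_cases hu : u < W ω <;> simp [hu]
  have h := integral_integral_covariance (P := P) (h_meas hg hX) hg_int.abs (h_le g X)
    (h_meas hk hY) hk_int.abs (h_le k Y)
  simp only [h_integral, covariance_smul_left, covariance_smul_right] at h
  rw [← h]
  simp only [mul_left_comm, mul_assoc]

lemma ofReal_abs_covariance_setIntegral_Iio_le (hX : Measurable X) (hY : Measurable Y)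
    (hg : Measurable g) (hg_int : Integrable g ν) :
    ENNReal.ofReal
        |cov[fun ω => ∫ u in Set.Iio (X ω), g u ∂ν, fun ω => ∫ v in Set.Iio (Y ω), g v ∂ν; P]| ≤
      ∫⁻ v, ∫⁻ u, ENNReal.ofReal |cov[{ω | u < X ω}.indicator (fun _ => (1 : ℝ)),
        {ω | v < Y ω}.indicator (fun _ => (1 : ℝ)); P]|
          ∂(ν.withDensity fun x => ‖g x‖ₑ) ∂(ν.withDensity fun x => ‖g x‖ₑ) := by
  have h_density (f : ℝ → ENNReal) :
      ∫⁻ x, f x ∂(ν.withDensity fun x => ‖g x‖ₑ) = ∫⁻ x, ‖g x‖ₑ * f x ∂ν :=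
    lintegral_withDensity_eq_lintegral_mul_non_measurable _ hg.enorm
      (Eventually.of_forall fun x => enorm_lt_top) f
  rw [covariance_setIntegral_Iio hX hY hg hg_int hg hg_int, ← Real.enorm_eq_ofReal_abs]
  refine (enorm_integral_le_lintegral_enorm _).trans ?_
  rw [h_density]
  refine lintegral_mono fun v => (enorm_integral_le_lintegral_enorm _).trans (le_of_eq ?_)
  rw [h_density, ← lintegral_const_mul' _ _ enorm_ne_top]
  refine lintegral_congr fun u => ?_
  rw [enorm_mul, enorm_mul, Real.enorm_eq_ofReal_abs (cov[_, _; P])]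
  ring

end Hoeffding

section GaussianBump

lemma integral_cos_mul_gaussianReal (x : ℝ) :
    ∫ s, Real.cos (s * x) ∂gaussianReal 0 1 = Real.exp (-x ^ 2 / 2) := by
  have h := integral_cos_mul_eq_re_charFun (P := gaussianReal 0 1) aemeasurable_id x
  rw [Measure.map_id, charFun_gaussianReal] at h
  simp only [id_eq, mul_comm x] at h
  rw [h, ← Complex.ofReal_re (Real.exp _)]
  push_cast
  congr 2
  ring

lemma integrable_neg_mul_exp_neg_sq_div_two :
    Integrable fun u : ℝ => -u * Real.exp (-u ^ 2 / 2) := by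
  convert (integrable_mul_exp_neg_mul_sq (b := 1 / 2) (by norm_num)).neg using 2 with u
  rw [Pi.neg_apply, neg_mul]
  congr 3
  ring

lemma setIntegral_Iio_neg_mul_exp_neg_sq_div_two (x : ℝ) :
    ∫ u in Set.Iio x, -u * Real.exp (-u ^ 2 / 2) = Real.exp (-x ^ 2 / 2) := by
  have h_deriv (u : ℝ) :
      HasDerivAt (fun u => Real.exp (-u ^ 2 / 2)) (-u * Real.exp (-u ^ 2 / 2)) u := by
    convert ((hasDerivAt_pow 2 u).fun_neg.div_const 2).exp using 1
    ring
  have h_tendsto : Tendsto (fun u : ℝ => Real.exp (-u ^ 2 / 2)) atBot (𝓝 0) := by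
    have h_sq : Tendsto (fun u : ℝ => u ^ 2) atBot atTop := by
      simpa only [Function.comp_def, sq_abs] using
        (tendsto_pow_atTop (α := ℝ) two_ne_zero).comp tendsto_abs_atBot_atTop
    exact Real.tendsto_exp_atBot.comp ((tendsto_neg_atTop_atBot.comp h_sq).atBot_div_const two_pos)
  rw [← integral_Iic_eq_integral_Iio, integral_Iic_of_hasDerivAt_of_tendsto' (fun u _ => h_deriv u)
    integrable_neg_mul_exp_neg_sq_div_two.integrableOn h_tendsto, sub_zero]

end GaussianBump

section FrequencyWeight

/-- A lower bound, up to a factor independent of the frequencies, for the covariance of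
`cos (u * X s)` and `cos (v * X t)` is `frequencyWeight α K u * frequencyWeight α K v`, where `X`
is a symmetric `α`-stable moving average whose kernel `m` satisfies `∫ |m| ^ α = K`. -/
noncomputable def frequencyWeight (α K u : ℝ) : ℝ :=
  Real.exp (-(|u| ^ α * K)) * min 1 (|u| ^ α)

variable {α K : ℝ}

lemma measurable_frequencyWeight : Measurable (frequencyWeight α K) := by
  unfold frequencyWeight
  fun_prop

lemma frequencyWeight_nonneg (u : ℝ) : 0 ≤ frequencyWeight α K u :=
  mul_nonneg (Real.exp_pos _).le (by positivity)

lemma frequencyWeight_pos {u : ℝ} (hu : u ≠ 0) : 0 < frequencyWeight α K u :=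
  mul_pos (Real.exp_pos _) (lt_min one_pos (Real.rpow_pos_of_pos (abs_pos.2 hu) α))

lemma frequencyWeight_le_one (hK : 0 ≤ K) (u : ℝ) : frequencyWeight α K u ≤ 1 :=
  mul_le_one₀ (Real.exp_le_one_iff.2 (neg_nonpos.2 (by positivity))) (by positivity)
    (min_le_left _ _)

variable {γ : Measure ℝ} [IsFiniteMeasure γ]

lemma integrable_frequencyWeight (hK : 0 ≤ K) : Integrable (frequencyWeight α K) γ :=
  .of_bound measurable_frequencyWeight.aestronglyMeasurable 1 (Eventually.of_forall fun u => by
    simpa [abs_of_nonneg (frequencyWeight_nonneg u)] using frequencyWeight_le_one hK u)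

lemma integral_frequencyWeight_pos [NeZero γ] [NullSingletonClass γ] (hK : 0 ≤ K) :
    0 < ∫ u, frequencyWeight α K u ∂γ := by
  refine (integral_nonneg frequencyWeight_nonneg).lt_of_ne' fun h => ?_
  have h_ae_zero := (integral_eq_zero_iff_of_nonneg frequencyWeight_nonneg
    (integrable_frequencyWeight hK)).1 h
  obtain ⟨u, hu_zero, hu⟩ :=
    (h_ae_zero.and ((Set.countable_singleton (0 : ℝ)).ae_notMem γ)).exists
  exact (frequencyWeight_pos hu).ne' hu_zero

lemma min_one_mul_min_one_mul_min_le {a b x y : ℝ} (ha : 0 ≤ a) (hb : 0 ≤ b) (hx : 0 ≤ x)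
    (hy : 0 ≤ y) : min 1 a * min 1 b * min x y ≤ min (a * x) (b * y) := by
  refine le_min ?_ ?_
  · calc min 1 a * min 1 b * min x y ≤ a * 1 * x := by
          gcongr
          exacts [min_le_right _ _, min_le_left _ _, min_le_left _ _]
      _ = a * x := by rw [mul_one]
  · calc min 1 a * min 1 b * min x y ≤ 1 * b * y := by
          gcongr
          exacts [min_le_left _ _, min_le_right _ _, min_le_right _ _]
      _ = b * y := by rw [one_mul]

lemma min_one_mul_min_one_mul_integral_min_le {𝓧 : Type*} [MeasurableSpace 𝓧] {μ : Measure 𝓧}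
    {F G : 𝓧 → ℝ} {a b : ℝ} (ha : 0 ≤ a) (hb : 0 ≤ b) (hF : Integrable F μ) (hG : Integrable G μ)
    (hF0 : 0 ≤ F) (hG0 : 0 ≤ G) :
    min 1 a * min 1 b * ∫ x, min (F x) (G x) ∂μ ≤ ∫ x, min (a * F x) (b * G x) ∂μ := by
  rw [← integral_const_mul]
  exact integral_mono ((hF.inf hG).const_mul _) ((hF.const_mul a).inf (hG.const_mul b)) fun x =>
    min_one_mul_min_one_mul_min_le ha hb (hF0 x) (hG0 x)

end FrequencyWeight

section GaussianTransform

variable {Ω : Type*} [MeasurableSpace Ω] {P : Measure Ω} {α : ℝ}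
  {m : ℝ → ℝ} {X : ℝ → Ω → ℝ}

namespace IsSaSMovingAverage

lemma integrable_abs_kernel_rpow (hα : 0 < α) (hX : IsSaSMovingAverage P α m X) (t : ℝ) :
    Integrable (fun x => |m (t - x)| ^ α) :=
  integrable_norm_rpow_of_memLp hα (hX.memLp_kernel_sub_left t)

variable [IsProbabilityMeasure P]

lemma frequencyWeight_mul_le_covariance_cos (hα0 : 0 < α) (hα2 : α ≤ 2)
    (hX : IsSaSMovingAverage P α m X) (s t u v : ℝ) :
    frequencyWeight α (∫ x, |m x| ^ α) u * (frequencyWeight α (∫ x, |m x| ^ α) v *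
        ((2 - α) / 2 * ∫ x, min (|m (s - x)| ^ α) (|m (t - x)| ^ α))) ≤
      cov[fun ω => Real.cos (u * X s ω), fun ω => Real.cos (v * X t ω); P] := by
  obtain ⟨Λ, hΛ, hX_int⟩ := hX.exists_integral
  have h_scaled (c τ x : ℝ) : |(c • fun x => m (τ - x)) x| ^ α = |c| ^ α * |m (τ - x)| ^ α := by
    rw [Pi.smul_apply, smul_eq_mul, abs_mul, Real.mul_rpow (abs_nonneg c) (abs_nonneg _)]
  have h_scale (c τ : ℝ) :
      ∫ x, |(c • fun x => m (τ - x)) x| ^ α = |c| ^ α * ∫ x, |m x| ^ α := by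
    simp only [h_scaled]
    rw [integral_const_mul, integral_sub_left_eq_self (fun x => |m x| ^ α) volume τ]
  have h_min : min 1 (|u| ^ α) * min 1 (|v| ^ α) *
      ∫ x, min (|m (s - x)| ^ α) (|m (t - x)| ^ α) ≤
        ∫ x, min (|(u • fun x => m (s - x)) x| ^ α) (|(v • fun x => m (t - x)) x| ^ α) := by
    simp only [h_scaled]
    exact min_one_mul_min_one_mul_integral_min_le (by positivity) (by positivity)
      (hX.integrable_abs_kernel_rpow hα0 s) (hX.integrable_abs_kernel_rpow hα0 t)
      (fun x => by positivity) fun x => by positivity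
  have h_cov := IsStableIntegral.exp_neg_mul_integral_min_le_covariance_cos_cos hα0 hα2 hΛ
    ((hX.memLp_kernel_sub_left s).const_smul u) ((hX.memLp_kernel_sub_left t).const_smul v)
    ((hX_int s).const_smul hΛ u) ((hX_int t).const_smul hΛ v)
  rw [h_scale, h_scale, neg_add, Real.exp_add] at h_cov
  have h_half : 0 ≤ (2 - α) / 2 := by linarith
  refine le_trans ?_ h_cov
  calc _ = Real.exp (-(|u| ^ α * ∫ x, |m x| ^ α)) * Real.exp (-(|v| ^ α * ∫ x, |m x| ^ α)) *
        ((2 - α) / 2 * (min 1 (|u| ^ α) * min 1 (|v| ^ α) *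
          ∫ x, min (|m (s - x)| ^ α) (|m (t - x)| ^ α))) := by
        unfold frequencyWeight
        ring
    _ ≤ _ :=
        mul_le_mul_of_nonneg_left (mul_le_mul_of_nonneg_left h_min h_half) (by positivity)

lemma mul_integral_min_le_covariance_exp_neg_sq_div_two (hα0 : 0 < α) (hα2 : α ≤ 2)
    (hX : IsSaSMovingAverage P α m X) (s t : ℝ) :
    (∫ u, frequencyWeight α (∫ x, |m x| ^ α) u ∂gaussianReal 0 1) *
        ((∫ u, frequencyWeight α (∫ x, |m x| ^ α) u ∂gaussianReal 0 1) *
          ((2 - α) / 2 * ∫ x, min (|m (s - x)| ^ α) (|m (t - x)| ^ α))) ≤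
      cov[fun ω => Real.exp (-X s ω ^ 2 / 2), fun ω => Real.exp (-X t ω ^ 2 / 2); P] := by
  have hK : 0 ≤ ∫ x, |m x| ^ α := integral_nonneg fun x => by positivity
  have h_meas (τ : ℝ) : Measurable (Function.uncurry fun u ω => Real.cos (u * X τ ω)) :=
    Real.measurable_cos.comp (measurable_fst.mul ((hX.measurable τ).comp measurable_snd))
  have h_bound (τ u : ℝ) (ω : Ω) : |Real.cos (u * X τ ω)| ≤ 1 := Real.abs_cos_le_one _
  simpa only [integral_cos_mul_gaussianReal] using
    integral_mul_integral_mul_le_covariance_integral (ν := gaussianReal 0 1)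
      (τ := gaussianReal 0 1) (h_meas s) (integrable_const 1) (h_bound s)
      (h_meas t) (integrable_const 1) (h_bound t) (integrable_frequencyWeight hK)
      (integrable_frequencyWeight hK) (hX.frequencyWeight_mul_le_covariance_cos hα0 hα2 s t)

end IsSaSMovingAverage

end GaussianTransform

section ExcursionCovariance

lemma lintegral_lintegral_sub_sub {G : Type*} [MeasurableSpace G] [AddGroup G] [MeasurableAdd₂ G]
    [MeasurableNeg G] {μ : Measure G} [SFinite μ] [μ.IsAddLeftInvariant] [μ.IsAddRightInvariant]
    [μ.IsNegInvariant] {H : G → G → ENNReal} (hH : Measurable (Function.uncurry H)) (s : G) :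
    ∫⁻ t, ∫⁻ x, H (s - x) (t - x) ∂μ ∂μ = ∫⁻ x, ∫⁻ t, H x t ∂μ ∂μ := by
  have h_meas : Measurable (Function.uncurry fun t x => H (s - x) (t - x)) :=
    hH.comp ((measurable_const.sub measurable_snd).prodMk (measurable_fst.sub measurable_snd))
  rw [lintegral_lintegral_swap h_meas.aemeasurable,
    ← lintegral_sub_left_eq_self (fun x => ∫⁻ t, H x t ∂μ) s]
  exact lintegral_congr fun x => lintegral_sub_right_eq_self (fun t => H (s - x) t) x

variable {Ω : Type*} [MeasurableSpace Ω] {P : Measure Ω} {α : ℝ} {m : ℝ → ℝ} {X : ℝ → Ω → ℝ}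

namespace IsSaSMovingAverage

lemma lintegral_ofReal_integral_min (hα : 0 < α) (hX : IsSaSMovingAverage P α m X) (s : ℝ) :
    ∫⁻ t, ENNReal.ofReal (∫ x, min (|m (s - x)| ^ α) (|m (t - x)| ^ α)) =
      ∫⁻ t, ∫⁻ x, ENNReal.ofReal (min (|m x| ^ α) (|m t| ^ α)) := by
  have h_meas := hX.measurable_kernel
  have h_inner (t : ℝ) : ENNReal.ofReal (∫ x, min (|m (s - x)| ^ α) (|m (t - x)| ^ α)) =
      ∫⁻ x, ENNReal.ofReal (min (|m (s - x)| ^ α) (|m (t - x)| ^ α)) :=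
    ofReal_integral_eq_lintegral_ofReal
      ((hX.integrable_abs_kernel_rpow hα s).inf (hX.integrable_abs_kernel_rpow hα t))
      (Eventually.of_forall fun x => by positivity)
  simp only [h_inner]
  rw [lintegral_lintegral_sub_sub
    (H := fun x t => ENNReal.ofReal (min (|m x| ^ α) (|m t| ^ α))) (by fun_prop)]
  simp only [min_comm]

end IsSaSMovingAverage

/-- The finite measure with density `|u| * exp (-u ^ 2 / 2)`, the absolute value of the derivative
of `exp (-u ^ 2 / 2)`. It serves as the measure on the levels of the excursion sets. -/
noncomputable def excursionLevelMeasure : Measure ℝ :=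
  volume.withDensity fun u => ‖-u * Real.exp (-u ^ 2 / 2)‖ₑ

instance : IsFiniteMeasure excursionLevelMeasure :=
  isFiniteMeasure_withDensity integrable_neg_mul_exp_neg_sq_div_two.2.ne

lemma ofReal_covariance_exp_neg_sq_div_two_le [IsProbabilityMeasure P] (hX : ∀ t, Measurable (X t))
    (t : ℝ) :
    ENNReal.ofReal cov[fun ω => Real.exp (-X 0 ω ^ 2 / 2), fun ω => Real.exp (-X t ω ^ 2 / 2); P] ≤
      ∫⁻ v, ∫⁻ u, ENNReal.ofReal |excursionCov P X t u v|
        ∂excursionLevelMeasure ∂excursionLevelMeasure := by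
  have h := ofReal_abs_covariance_setIntegral_Iio_le (P := P) (hX 0) (hX t) (by fun_prop)
    integrable_neg_mul_exp_neg_sq_div_two
  simp only [setIntegral_Iio_neg_mul_exp_neg_sq_div_two] at h
  exact (ENNReal.ofReal_le_ofReal (le_abs_self _)).trans h

end ExcursionCovariance

theorem mainTheorem3_general {Ω : Type*} [MeasurableSpace Ω] (P : Measure Ω)
    [IsProbabilityMeasure P] (α : ℝ) (hα0 : 0 < α) (hα2 : α < 2) (m : ℝ → ℝ)
    (X : ℝ → Ω → ℝ) (hX : IsSaSMovingAverage P α m X)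
    (hmin : ∫⁻ t : ℝ, ∫⁻ x : ℝ, ENNReal.ofReal (min (|m x| ^ α) (|m t| ^ α)) = ⊤) :
    IsLongRangeDependent P X := by
  refine ⟨hX.isStationaryProcess hα0, excursionLevelMeasure, inferInstance, eq_top_iff.2 ?_⟩
  set w := ∫ u, frequencyWeight α (∫ x, |m x| ^ α) u ∂gaussianReal 0 1
  have hw : 0 < w :=
    have := nullSingletonClass_gaussianReal (μ := 0) (v := 1) one_ne_zero
    integral_frequencyWeight_pos (integral_nonneg fun x => by positivity)
  have hc : 0 < w * w * ((2 - α) / 2) := by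
    have : 0 < 2 - α := sub_pos.2 hα2
    positivity
  calc (⊤ : ENNReal)
      = ENNReal.ofReal (w * w * ((2 - α) / 2)) *
          ∫⁻ t, ENNReal.ofReal (∫ x, min (|m (0 - x)| ^ α) (|m (t - x)| ^ α)) := by
        rw [hX.lintegral_ofReal_integral_min hα0, hmin,
          ENNReal.mul_top (ENNReal.ofReal_pos.2 hc).ne']
    _ = ∫⁻ t, ENNReal.ofReal (w * w * ((2 - α) / 2) *
          ∫ x, min (|m (0 - x)| ^ α) (|m (t - x)| ^ α)) := by
        simp only [ENNReal.ofReal_mul hc.le, lintegral_const_mul' _ _ ENNReal.ofReal_ne_top]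
    _ ≤ ∫⁻ t, ENNReal.ofReal
          cov[fun ω => Real.exp (-X 0 ω ^ 2 / 2), fun ω => Real.exp (-X t ω ^ 2 / 2); P] := by
        gcongr with t
        simpa only [mul_assoc] using
          hX.mul_integral_min_le_covariance_exp_neg_sq_div_two hα0 hα2.le 0 t
    _ ≤ _ := lintegral_mono (ofReal_covariance_exp_neg_sq_div_two_le hX.measurable)

theorem mainTheorem3 {Ω : Type*} [MeasurableSpace Ω] (P : Measure Ω) [IsProbabilityMeasure P]
    (α : ℝ) (hα0 : 0 < α) (hα2 : α < 2)
    (m : ℝ → ℝ) (hm : ∀ x, 0 ≤ m x)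
    (X : ℝ → Ω → ℝ) (hX : IsSaSMovingAverage P α m X)
    (hmin : ∫⁻ t : ℝ, ∫⁻ x : ℝ, ENNReal.ofReal (min (m x ^ α) (m t ^ α)) = ⊤) :
    IsLongRangeDependent P X :=
  mainTheorem3_general P α hα0 hα2 m X hX (by simpa only [abs_of_nonneg (hm _)] using hmin)
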